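/- Let $q\ge 2$ and $\mathcal Q=\{1,\dots,q\}$, and let $\nu$ be a real-valued function on the subsets (coalitions) of $\mathcal Q$ with $\nu(\emptyset)=0$. Identify a coalition $C\subseteq\mathcal Q$ with its indicator vector $\boldsymbol Z=(Z_1,\dots,Z_q)^\top\in\{0,1\}^q$, write $\nu(\boldsymbol Z)=\nu(C)$, and let $\boldsymbol 1$ be the all-ones vector. Assume that $\nu$ is not a linear form, i.e. there is no $\boldsymbol\beta\in\mathbb R^q$ with $\nu(\boldsymbol Z)=\boldsymbol\beta^\top\boldsymbol Z$ for all $\boldsymbol Z\in\{0,1\}^q$. Let $p$ be the probability distribution on the coalitions with $$p(C)\;\propto\;\frac{q-1}{\binom{q}{|C|}\,|C|\,(q-|C|)}\qquad(\emptyset\ne C\subsetneq\mathcal Q),\qquad p(\emptyset)=p(\mathcal Q)=0 .$$ For $\boldsymbol Z\in\{0,1\}^q$ put $W(\boldsymbol Z)=(Z_1-Z_q,\dots,Z_{q-1}-Z_q)^\top\in\mathbb R^{q-1}$ and $Y(\boldsymbol Z)=\nu(\boldsymbol Z)-Z_q\,\nu(\boldsymbol 1)$, and define $$\mathcal J=\mathbb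 E_{\boldsymbol Z\sim p}\big[W(\boldsymbol Z)W(\boldsymbol Z)^\top\big],\qquad \widetilde{\boldsymbol\phi}=\mathcal J^{-1}\,\mathbb E_{\boldsymbol Z\sim p}\big[Y(\boldsymbol Z)W(\boldsymbol Z)\big],$$ $$\mathcal I=\mathbb E_{\boldsymbol Z\sim p}\Big[\big(Y(\boldsymbol Z)-W(\boldsymbol Z)^\top\widetilde{\boldsymbol\phi}\big)^2\,W(\boldsymbol Z)W(\boldsymbol Z)^\top\Big].$$ Let $\boldsymbol Z_1,\boldsymbol Z_2,\dots$ be i.i.d. with law $p$. For $n\ge 1$ let $\mathfrak Z_n\in\mathbb R^{n\times(q-1)}$ be the matrix with rows $W(\boldsymbol Z_i)^\top$ and $\boldsymbol Y_n=(Y(\boldsymbol Z_1),\dots,Y(\boldsymbol Z_n))^\top$. Let $\widehat{\boldsymbol\phi}_n$ be any random vector in $\mathbb R^{q-1}$ (the Sampling KernelSHAP estimator) with $$\widehat{\boldsymbol\phi}_n=(\mathfrak Z_n^\top\mathfrak Z_n)^{-1}\mathfrak Z_n^\top\boldsymbol Y_n\quad\text{whenever }\mathfrak Z_n\text{ has full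 rank }q-1,$$ its values being arbitrary otherwise. Then $\mathcal J$ is invertible and, as $n\to\infty$, $$\sqrt n\,\big(\widehat{\boldsymbol\phi}_n-\widetilde{\boldsymbol\phi}\big)\;\Longrightarrow\;\mathcal N\big(\boldsymbol 0,\ \mathcal J^{-1}\mathcal I\,\mathcal J^{-1}\big)$$ in distribution (the Gaussian law being possibly degenerate). -/

import Mathlib

open MeasureTheory ProbabilityTheory Filter Matrix
open scoped Topology

namespace KernelSHAP

noncomputable section

/-! Throughout there are `q = d + 1` players, indexed by `Fin (d + 1)`; the `q`-th player is
`Fin.last d` and the first `q - 1` players are `Fin.castSucc j`, `j : Fin d`.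
Coalitions are finite sets of players. -/

/-- The binary vector `Z ∈ {0,1}^q` of the coalition `C`. -/
def binVec {q : ℕ} (C : Finset (Fin q)) : Fin q → ℝ := fun j => if j ∈ C then 1 else 0

/-- The value function is a linear form `ν(Z) = βᵀ Z`. -/
def IsLinearForm {q : ℕ} (ν : Finset (Fin q) → ℝ) : Prop :=
  ∃ β : Fin q → ℝ, ∀ C, ν C = β ⬝ᵥ binVec C

/-- The unnormalized Shapley kernel weight; it is zero for the empty and the grand coalition. -/
def kernelWeight {q : ℕ} (C : Finset (Fin q)) : ℝ :=
  if C = ∅ ∨ C = Finset.univ then 0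
  else ((q : ℝ) - 1) / ((q.choose C.card : ℝ) * (C.card : ℝ) * ((q : ℝ) - (C.card : ℝ)))

/-- The normalized weight `p(C)`. -/
def kernelProb {q : ℕ} (C : Finset (Fin q)) : ℝ :=
  (∑ C' : Finset (Fin q), kernelWeight C')⁻¹ * kernelWeight C

/-- The expectation `E_{Z ∼ p}[f(Z)]`. -/
def expect {q : ℕ} {E : Type*} [AddCommGroup E] [Module ℝ E] (f : Finset (Fin q) → E) : E :=
  ∑ C : Finset (Fin q), kernelProb C • f C

/-- The covariate `Z̃ - Z_q 1̃ ∈ ℝ^{q-1}`. -/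
def covariate {d : ℕ} (C : Finset (Fin (d + 1))) : Fin d → ℝ :=
  fun j => binVec C j.castSucc - binVec C (Fin.last d)

/-- The response `ν(Z) - Z_q ν(1)`. -/
def response {d : ℕ} (ν : Finset (Fin (d + 1)) → ℝ) (C : Finset (Fin (d + 1))) : ℝ :=
  ν C - binVec C (Fin.last d) * ν Finset.univ

/-- The matrix `J = E[(Z̃ - Z_q 1̃)(Z̃ - Z_q 1̃)ᵀ]`. -/
def matJ (d : ℕ) : Matrix (Fin d) (Fin d) ℝ :=
  expect fun C : Finset (Fin (d + 1)) => vecMulVec (covariate C) (covariate C)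

/-- The population solution `φ̃ = J⁻¹ E[(ν(Z) - Z_q ν(1))(Z̃ - Z_q 1̃)]`. -/
def phiTilde {d : ℕ} (ν : Finset (Fin (d + 1)) → ℝ) : EuclideanSpace ℝ (Fin d) :=
  WithLp.toLp 2 ((matJ d)⁻¹ *ᵥ expect fun C => response ν C • covariate C)

/-- The matrix
`I = E[(ν(Z) - Z_q ν(1) - (Z̃ - Z_q 1̃)ᵀ φ̃)² (Z̃ - Z_q 1̃)(Z̃ - Z_q 1̃)ᵀ]`. -/
def matI {d : ℕ} (ν : Finset (Fin (d + 1)) → ℝ) : Matrix (Fin d) (Fin d) ℝ :=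
  expect fun C =>
    (response ν C - covariate C ⬝ᵥ (phiTilde ν).ofLp) ^ 2 • vecMulVec (covariate C) (covariate C)

/-- The design matrix of a sample of `n` coalitions. -/
def design {d n : ℕ} (z : Fin n → Finset (Fin (d + 1))) : Matrix (Fin n) (Fin d) ℝ :=
  Matrix.of fun i => covariate (z i)

/-- The least-squares estimate `(XᵀX)⁻¹ Xᵀ Y` (meaningful when the design matrix `X` has
full column rank). -/
def lsEstimate {d n : ℕ} (ν : Finset (Fin (d + 1)) → ℝ) (z : Fin n → Finset (Fin (d + 1))) :
    EuclideanSpace ℝ (Fin d) :=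
  WithLp.toLp 2
    (((design z)ᵀ * design z)⁻¹ *ᵥ ((design z)ᵀ *ᵥ fun i => response ν (z i)))

end

end KernelSHAP

/-! This is asymptotic normality of least squares with random design and no correct linear model.
Write r for the residual of the population regression and Ĵₙ = n⁻¹XᵀX. Whenever Ĵₙ is invertible,
the rescaled error equals exactly Ĵₙ⁻¹J times n^{-1/2} Σ J⁻¹ r(Zᵢ)W(Zᵢ)
(`sqrt_smul_lsEstimate_sub`). The summands are i.i.d., bounded, centred by the normal equations, and
have the sandwich covariance, so the central limit theorem applies. By the strong law Ĵₙ → J almost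
surely; J is positive definite (`posDef_matJ`), so Ĵₙ⁻¹J → 1 and Slutsky's lemma gives the limit.
Almost surely Ĵₙ is eventually invertible, so the arbitrary values of the estimator do not matter.
-/

namespace KernelSHAP

/-! ### Central limit theorem in several dimensions -/

section CentralLimit

variable {Ω ι : Type*} [MeasurableSpace Ω] {P : Measure Ω} [IsProbabilityMeasure P]
  [Fintype ι] [DecidableEq ι]

/-- **Multivariate central limit theorem** for centred, square integrable random vectors with
covariance matrix `S` (possibly singular). -/
theorem tendstoInDistribution_multivariateGaussian {X : ℕ → Ω → EuclideanSpace ℝ ι}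
    {S : Matrix ι ι ℝ} (hS : S.PosSemidef) (hX : MemLp (X 0) 2 P) (hindep : iIndepFun X P)
    (hident : ∀ i, IdentDistrib (X i) (X 0) P P) (hmean : P[X 0] = 0)
    (hcov : ∀ t : EuclideanSpace ℝ ι, ∫ ω, inner ℝ t (X 0 ω) ^ 2 ∂P = t.ofLp ⬝ᵥ S *ᵥ t.ofLp) :
    TendstoInDistribution (fun (n : ℕ) ω => (√n)⁻¹ • ∑ k ∈ Finset.range n, X k ω) atTop
      (id : EuclideanSpace ℝ ι → EuclideanSpace ℝ ι) (fun _ => P)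
      (multivariateGaussian 0 S) where
  forall_aemeasurable n := by
    have := fun i => (hident i).aemeasurable_fst
    fun_prop
  tendsto := by
    have hmeas := fun i => (hident i).aemeasurable_fst
    refine ProbabilityMeasure.tendsto_iff_tendsto_charFun.2 fun t => ?_
    have hm : ∫ ω, inner ℝ t (X 0 ω) ∂P = 0 := by
      rw [integral_inner (hX.integrable one_le_two), hmean, inner_zero_right]
    have hL : MemLp (fun ω => inner ℝ t (X 0 ω)) 2 P := hX.const_inner t
    have hvar : Var[fun ω => inner ℝ t (X 0 ω); P] = t.ofLp ⬝ᵥ S *ᵥ t.ofLp := by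
      rw [variance_of_integral_eq_zero hL.aestronglyMeasurable.aemeasurable hm]
      exact hcov t
    -- Cramér–Wold: the characteristic function of a vector at `t` is that of its projection onto
    -- `t` at 1, so the scalar theorem suffices.
    have hclt := tendstoInDistribution_inv_sqrt_mul_sum_sub (P := P)
      (P' := gaussianReal 0 Var[fun ω => inner ℝ t (X 0 ω); P].toNNReal) (Y := id)
      (X := fun i ω => inner ℝ t (X i ω)) ⟨aemeasurable_id, Measure.map_id⟩ hL
      (hindep.comp (fun _ x => inner ℝ t x) fun _ => by fun_prop)
      (fun i => (hident i).comp (u := fun x => inner ℝ t x) (by fun_prop))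
    have h1 := ProbabilityMeasure.tendsto_iff_tendsto_charFun.1 hclt.tendsto 1
    simp only [ProbabilityMeasure.coe_mk, Measure.map_id] at h1 ⊢
    rw [charFun_gaussianReal, hvar] at h1
    rw [charFun_multivariateGaussian hS]
    have hnn : 0 ≤ t.ofLp ⬝ᵥ S *ᵥ t.ofLp := hvar ▸ variance_nonneg _ _
    convert h1 using 2 with n
    · rw [charFun_apply, charFun_apply, integral_map (by fun_prop) (by fun_prop),
        integral_map (by fun_prop) (by fun_prop)]
      refine integral_congr_ae (ae_of_all _ fun ω => ?_)
      simp [hm, real_inner_comm t, inner_smul_right, inner_sum]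
    · simp [Real.coe_toNNReal _ hnn]

end CentralLimit

/-! ### Kernel weights and positivity of J -/

section Weights

variable {q d : ℕ}

theorem kernelWeight_pos {C : Finset (Fin q)} (h0 : C ≠ ∅) (h1 : C ≠ Finset.univ) :
    0 < kernelWeight C := by
  have hc0 : 0 < C.card := Finset.card_pos.2 (Finset.nonempty_iff_ne_empty.2 h0)
  have hc1 : C.card < q := by
    simpa using Finset.card_lt_univ_of_notMem (Finset.eq_univ_iff_forall.not.trans not_forall |>.1 h1).choose_spec
  have hch : 0 < q.choose C.card := Nat.choose_pos hc1.le
  have h2 : (1 : ℝ) < q := by exact_mod_cast (show 1 < q by omega)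
  have h3 : (C.card : ℝ) < q := by exact_mod_cast hc1
  rw [kernelWeight, if_neg (by simp [h0, h1])]
  have h4 : (0 : ℝ) < q - 1 := by linarith
  have h5 : (0 : ℝ) < q - C.card := by linarith
  positivity

theorem kernelWeight_nonneg (C : Finset (Fin q)) : 0 ≤ kernelWeight C := by
  by_cases h : C = ∅ ∨ C = Finset.univ
  · rw [kernelWeight, if_pos h]
  · rw [not_or] at h
    exact (kernelWeight_pos h.1 h.2).le

theorem kernelProb_nonneg (C : Finset (Fin q)) : 0 ≤ kernelProb C :=
  mul_nonneg (inv_nonneg.2 (Finset.sum_nonneg fun C _ => kernelWeight_nonneg C))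
    (kernelWeight_nonneg C)

theorem kernelProb_pos {C : Finset (Fin q)} (h0 : C ≠ ∅) (h1 : C ≠ Finset.univ) :
    0 < kernelProb C := by
  refine mul_pos (inv_pos.2 ?_) (kernelWeight_pos h0 h1)
  exact Finset.sum_pos' (fun C _ => kernelWeight_nonneg C)
    ⟨C, Finset.mem_univ _, kernelWeight_pos h0 h1⟩

theorem map_expect {E F : Type*} [AddCommGroup E] [Module ℝ E] [AddCommGroup F] [Module ℝ F]
    (L : E →ₗ[ℝ] F) (f : Finset (Fin q) → E) : L (expect f) = expect fun C => L (f C) := by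
  simp [expect]

theorem expect_mulVec (f : Finset (Fin q) → Matrix (Fin d) (Fin d) ℝ) (x : Fin d → ℝ) :
    expect f *ᵥ x = expect fun C => f C *ᵥ x :=
  map_expect ((Matrix.mulVecBilin ℝ ℝ).flip x) f

theorem dotProduct_expect_vecMulVec_mulVec (c : Finset (Fin q) → ℝ)
    (w : Finset (Fin q) → Fin d → ℝ) (x : Fin d → ℝ) :
    x ⬝ᵥ (expect fun C => c C • vecMulVec (w C) (w C)) *ᵥ x =
      expect fun C => c C * (w C ⬝ᵥ x) ^ 2 := by
  rw [expect_mulVec]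
  simp only [expect, dotProduct_sum, dotProduct_smul, smul_mulVec, vecMulVec_mulVec]
  refine Finset.sum_congr rfl fun C _ => ?_
  rw [dotProduct_comm x (w C)]
  simp only [op_smul_eq_smul, smul_eq_mul]
  ring

theorem isHermitian_expect_vecMulVec (c : Finset (Fin q) → ℝ) (w : Finset (Fin q) → Fin d → ℝ) :
    (expect fun C => c C • vecMulVec (w C) (w C)).IsHermitian := by
  ext i j
  simp [expect, Matrix.sum_apply, vecMulVec_apply, mul_comm (w _ i)]

theorem covariate_singleton_castSucc (j : Fin d) : covariate {j.castSucc} = Pi.single j 1 := by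
  ext i
  simp [covariate, binVec, Pi.single_apply, (Fin.castSucc_lt_last j).ne']

/-- The quadratic form at x is E[(W·x)²]. If xⱼ ≠ 0, the coalition {j} has positive probability and
W = eⱼ, so it contributes a positive term. -/
theorem posDef_matJ (d : ℕ) : (matJ d).PosDef := by
  have hJ : matJ d = expect fun C : Finset (Fin (d + 1)) =>
      (1 : ℝ) • vecMulVec (covariate C) (covariate C) := by simp [matJ]
  refine .of_dotProduct_mulVec_pos (hJ ▸ isHermitian_expect_vecMulVec _ _) fun x hx => ?_
  obtain ⟨j, hj⟩ := Function.ne_iff.1 hx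
  rw [star_trivial, hJ, dotProduct_expect_vecMulVec_mulVec]
  refine Finset.sum_pos' (fun C _ => smul_nonneg (kernelProb_nonneg C) (by positivity))
    ⟨{j.castSucc}, Finset.mem_univ _, smul_pos (kernelProb_pos (by simp) ?_) ?_⟩
  · intro h
    have := h ▸ Finset.mem_univ (Fin.last d)
    simp [(Fin.castSucc_lt_last j).ne'] at this
  · simp only [covariate_singleton_castSucc, single_dotProduct, one_mul]
    exact sq_pos_of_ne_zero hj

end Weights
-- Moments and the strong law for sampled coalitions
section Sampling

variable {q : ℕ} {Ω : Type*} [MeasurableSpace Ω] {P : Measure Ω} [IsProbabilityMeasure P]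
  {Z : ℕ → Ω → Finset (Fin q)}

theorem identDistrib_of_kernelProb (hZm : ∀ i, Measurable (Z i))
    (hZlaw : ∀ i C, P.real (Z i ⁻¹' {C}) = kernelProb C) (i : ℕ) :
    IdentDistrib (Z i) (Z 0) P P where
  aemeasurable_fst := (hZm i).aemeasurable
  aemeasurable_snd := (hZm 0).aemeasurable
  map_eq := by
    refine Measure.ext_of_singleton fun C => ?_
    rw [Measure.map_apply (hZm i) (measurableSet_singleton C),
      Measure.map_apply (hZm 0) (measurableSet_singleton C),
      ← measureReal_eq_measureReal_iff, hZlaw, hZlaw]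

theorem integral_comp_eq_expect {E : Type*} [NormedAddCommGroup E] [NormedSpace ℝ E]
    [CompleteSpace E] {X : Ω → Finset (Fin q)} (hX : Measurable X)
    (hlaw : ∀ C, P.real (X ⁻¹' {C}) = kernelProb C) (f : Finset (Fin q) → E) :
    ∫ ω, f (X ω) ∂P = expect f := by
  rw [← integral_map hX.aemeasurable (f := f)
    StronglyMeasurable.of_discrete.aestronglyMeasurable, integral_fintype .of_finite]
  simp [expect, map_measureReal_apply hX, hlaw]

theorem memLp_comp_of_finite {E : Type*} [NormedAddCommGroup E] {X : Ω → Finset (Fin q)}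
    (hX : Measurable X) (f : Finset (Fin q) → E) (p : ENNReal) :
    MemLp (fun ω => f (X ω)) p P := by
  obtain ⟨M, hM⟩ := Finite.exists_le fun C => ‖f C‖
  exact .of_bound (StronglyMeasurable.of_discrete.comp_measurable hX).aestronglyMeasurable M
    (ae_of_all _ fun ω => hM _)

theorem ae_tendsto_average {E : Type*} [NormedAddCommGroup E] [NormedSpace ℝ E]
    [CompleteSpace E] [MeasurableSpace E] [BorelSpace E] (hZm : ∀ i, Measurable (Z i))
    (hZindep : iIndepFun Z P) (hZlaw : ∀ i C, P.real (Z i ⁻¹' {C}) = kernelProb C)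
    (f : Finset (Fin q) → E) :
    ∀ᵐ ω ∂P, Tendsto (fun n : ℕ => (n : ℝ)⁻¹ • ∑ i ∈ Finset.range n, f (Z i ω)) atTop
      (𝓝 (expect f)) := by
  rw [← integral_comp_eq_expect (hZm 0) (hZlaw 0) f]
  exact strong_law_ae (fun i ω => f (Z i ω))
    ((memLp_comp_of_finite (hZm 0) f 1).integrable le_rfl)
    (fun i j hij => (hZindep.indepFun hij).comp .of_discrete .of_discrete)
    fun i => (identDistrib_of_kernelProb hZm hZlaw i).comp (u := f) .of_discrete

end Sampling

/-! ### Algebra of the least-squares error -/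

section LeastSquares

variable {d : ℕ} (ν : Finset (Fin (d + 1)) → ℝ)

/-- The residual of the population regression at the coalition `C`. -/
noncomputable def residual (C : Finset (Fin (d + 1))) : ℝ :=
  response ν C - covariate C ⬝ᵥ (phiTilde ν).ofLp

/-- The influence function `J⁻¹ (Y(Z) - W(Z)ᵀ φ̃) W(Z)` of the least-squares estimator. -/
noncomputable def influence (C : Finset (Fin (d + 1))) : EuclideanSpace ℝ (Fin d) :=
  WithLp.toLp 2 ((matJ d)⁻¹ *ᵥ (residual ν C • covariate C))

/-- The sample analogue `n⁻¹ XᵀX` of the matrix `J`. -/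
noncomputable def sampleJ {n : ℕ} (z : Fin n → Finset (Fin (d + 1))) : Matrix (Fin d) (Fin d) ℝ :=
  (n : ℝ)⁻¹ • ((design z)ᵀ * design z)

theorem isUnit_det_matJ (d : ℕ) : IsUnit (matJ d).det :=
  (Matrix.isUnit_iff_isUnit_det _).1 (posDef_matJ d).isUnit

/-- These are the normal equations Jφ̃ = E[YW], which center the influence function. -/
theorem expect_residual_smul_covariate :
    (expect fun C => residual ν C • covariate C) = 0 := by
  have h : (matJ d *ᵥ (phiTilde ν).ofLp) = expect fun C => response ν C • covariate C := by
    rw [phiTilde, mulVec_mulVec, mul_nonsing_inv _ (isUnit_det_matJ d), one_mulVec]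
  have h' : (matJ d *ᵥ (phiTilde ν).ofLp) =
      expect fun C => (covariate C ⬝ᵥ (phiTilde ν).ofLp) • covariate C := by
    rw [matJ, expect_mulVec]
    simp [vecMulVec_mulVec]
  simp only [residual, sub_smul]
  rw [show (expect fun C => response ν C • covariate C -
      (covariate C ⬝ᵥ (phiTilde ν).ofLp) • covariate C) =
      (expect fun C => response ν C • covariate C) -
      expect fun C => (covariate C ⬝ᵥ (phiTilde ν).ofLp) • covariate C by
    simp [expect, smul_sub], ← h, ← h', sub_self]

theorem expect_influence : expect (influence ν) = 0 := by
  have := map_expect ((WithLp.linearEquiv 2 ℝ (Fin d → ℝ)).symm.toLinearMap ∘ₗ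
    (matJ d)⁻¹.mulVecLin) fun C => residual ν C • covariate C
  rw [expect_residual_smul_covariate, map_zero] at this
  exact this.symm

theorem transpose_inv_matJ (d : ℕ) : ((matJ d)⁻¹)ᵀ = (matJ d)⁻¹ := by
  simpa [IsHermitian] using (posDef_matJ d).isHermitian.inv

/-- Since J⁻¹ is symmetric, ⟨t, J⁻¹rW⟩ = r W·(J⁻¹t), whose second moment is the form of `matI` at
J⁻¹t. -/
theorem expect_inner_influence_sq (t : EuclideanSpace ℝ (Fin d)) :
    (expect fun C => inner ℝ t (influence ν C) ^ 2) =
      t.ofLp ⬝ᵥ ((matJ d)⁻¹ * matI ν * (matJ d)⁻¹) *ᵥ t.ofLp := by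
  rw [← mulVec_mulVec, ← mulVec_mulVec, dotProduct_mulVec, ← mulVec_transpose,
    transpose_inv_matJ, matI, dotProduct_expect_vecMulVec_mulVec]
  congr 1 with C
  rw [EuclideanSpace.inner_eq_star_dotProduct, influence, star_trivial, dotProduct_comm,
    dotProduct_mulVec, ← mulVec_transpose, transpose_inv_matJ, dotProduct_smul, smul_eq_mul,
    mul_pow, dotProduct_comm _ (covariate C)]
  rfl

theorem posSemidef_sandwich : ((matJ d)⁻¹ * matI ν * (matJ d)⁻¹).PosSemidef := by
  have hI : (matI ν).IsHermitian := isHermitian_expect_vecMulVec _ _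
  refine .of_dotProduct_mulVec_nonneg ?_ fun x => ?_
  · have hJ := (posDef_matJ d).isHermitian.inv
    rw [IsHermitian, conjTranspose_mul, conjTranspose_mul, hI.eq, hJ.eq, Matrix.mul_assoc]
  · rw [star_trivial]
    have := expect_inner_influence_sq ν (WithLp.toLp 2 x)
    rw [← this]
    exact Finset.sum_nonneg fun C _ => smul_nonneg (kernelProb_nonneg C) (sq_nonneg _)

/-- Links invertibility of Ĵₙ, which the strong law supplies, to the rank condition under which the
estimator is specified. -/
theorem rank_design {n : ℕ} {z : Fin n → Finset (Fin (d + 1))} (h : IsUnit (sampleJ z).det) :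
    (design z).rank = d := by
  have h1 : (sampleJ z).rank ≤ (design z).rank := by
    rw [sampleJ, ← Matrix.smul_mul]
    exact rank_mul_le_right _ _
  rw [rank_of_isUnit _ ((Matrix.isUnit_iff_isUnit_det _).2 h), Fintype.card_fin] at h1
  exact le_antisymm ((rank_le_card_width _).trans_eq (Fintype.card_fin d)) h1

theorem sampleJ_eq_sum {n : ℕ} (z : Fin n → Finset (Fin (d + 1))) :
    sampleJ z = (n : ℝ)⁻¹ • ∑ i, vecMulVec (covariate (z i)) (covariate (z i)) := by
  ext j k
  simp [sampleJ, design, Matrix.mul_apply, Matrix.sum_apply, vecMulVec_apply]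

/-- The error of the least-squares estimate is linear in the averaged influence function. -/
theorem sqrt_smul_lsEstimate_sub {n : ℕ} {z : Fin n → Finset (Fin (d + 1))}
    (h : IsUnit (sampleJ z).det) (hn : n ≠ 0) :
    √n • (lsEstimate ν z - phiTilde ν) = WithLp.toLp 2 (((sampleJ z)⁻¹ * matJ d) *ᵥ
      ((√n)⁻¹ • ∑ i, influence ν (z i)).ofLp) := by
  have hn0 : (n : ℝ) ≠ 0 := by exact_mod_cast hn
  have hX : (design z)ᵀ * design z = (n : ℝ) • sampleJ z := by
    rw [sampleJ, smul_smul, mul_inv_cancel₀ hn0, one_smul]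
  have hXdet : IsUnit ((design z)ᵀ * design z).det := by
    rw [hX, det_smul]
    exact (IsUnit.mk0 _ (pow_ne_zero _ hn0)).mul h
  have hY : (fun i => response ν (z i)) =
      design z *ᵥ (phiTilde ν).ofLp + fun i => residual ν (z i) := by
    ext i
    simp [design, residual, mulVec, Matrix.of_apply]
  have hR : ∑ i, influence ν (z i) =
      WithLp.toLp 2 ((matJ d)⁻¹ *ᵥ ((design z)ᵀ *ᵥ fun i => residual ν (z i))) := by
    have : ((design z)ᵀ *ᵥ fun i => residual ν (z i)) =
        ∑ i, residual ν (z i) • covariate (z i) := by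
      ext j
      simp [mulVec, dotProduct, design, mul_comm]
    rw [this]
    simp only [influence, mulVec_sum, WithLp.toLp_sum]
  have hls : lsEstimate ν z - phiTilde ν = WithLp.toLp 2
      (((design z)ᵀ * design z)⁻¹ *ᵥ ((design z)ᵀ *ᵥ fun i => residual ν (z i))) := by
    rw [lsEstimate, hY, mulVec_add, mulVec_add, mulVec_mulVec _ (design z)ᵀ (design z),
      mulVec_mulVec _ _ ((design z)ᵀ * design z), nonsing_inv_mul _ hXdet, one_mulVec, WithLp.toLp_add, WithLp.toLp_ofLp, add_sub_cancel_left]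
  have hinv : ((n : ℝ) • sampleJ z)⁻¹ = (n : ℝ)⁻¹ • (sampleJ z)⁻¹ := by
    let := invertibleOfNonzero hn0
    rw [inv_smul _ _ h, invOf_eq_inv]
  rw [hls, hR, hX, hinv, ← WithLp.toLp_smul, ← WithLp.toLp_smul, WithLp.ofLp_toLp, mulVec_smul,
    mulVec_mulVec _ (_ * _) (matJ d)⁻¹, Matrix.mul_assoc, mul_nonsing_inv _ (isUnit_det_matJ d), Matrix.mul_one,
    smul_mulVec, smul_smul]
  congr 2
  rw [← Real.sqrt_div_self, div_eq_mul_inv]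

end LeastSquares
end KernelSHAP

open KernelSHAP

theorem mainTheorem1 (d : ℕ) (hd : 1 ≤ d)
    (ν : Finset (Fin (d + 1)) → ℝ) (hν0 : ν ∅ = 0) (hν : ¬ KernelSHAP.IsLinearForm ν)
    {Ω : Type*} [MeasurableSpace Ω] (P : Measure Ω) [IsProbabilityMeasure P]
    (Z : ℕ → Ω → Finset (Fin (d + 1)))
    (hZm : ∀ i, Measurable (Z i))
    (hZindep : iIndepFun Z P)
    (hZlaw : ∀ i C, P.real (Z i ⁻¹' {C}) = KernelSHAP.kernelProb C)
    (φhat : ℕ → Ω → EuclideanSpace ℝ (Fin d))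
    (hφm : ∀ n, AEMeasurable (φhat n) P)
    (hφ : ∀ n ω, (KernelSHAP.design fun i : Fin n => Z i ω).rank = d →
      φhat n ω = KernelSHAP.lsEstimate ν fun i : Fin n => Z i ω) :
    IsUnit (KernelSHAP.matJ d).det ∧
    TendstoInDistribution
      (fun (n : ℕ) ω => Real.sqrt n • (φhat n ω - KernelSHAP.phiTilde ν)) atTop
      (id : EuclideanSpace ℝ (Fin d) → EuclideanSpace ℝ (Fin d)) (fun _ => P)
      (multivariateGaussian 0
        ((KernelSHAP.matJ d)⁻¹ * KernelSHAP.matI ν * (KernelSHAP.matJ d)⁻¹)) := by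
  refine ⟨isUnit_det_matJ d, ?_⟩
  have hclt := tendstoInDistribution_multivariateGaussian (P := P)
    (X := fun i ω => influence ν (Z i ω)) (posSemidef_sandwich ν)
    (memLp_comp_of_finite (hZm 0) _ 2)
    (hZindep.comp (fun _ => influence ν) fun _ => .of_discrete)
    (fun i => (identDistrib_of_kernelProb hZm hZlaw i).comp (u := influence ν) .of_discrete)
    ((integral_comp_eq_expect (hZm 0) (hZlaw 0) _).trans (expect_influence ν))
    fun t => (integral_comp_eq_expect (hZm 0) (hZlaw 0)
      fun C => inner ℝ t (influence ν C) ^ 2).trans (expect_inner_influence_sq ν t)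
  have hJ : ∀ᵐ ω ∂P, Tendsto (fun n : ℕ => sampleJ fun i : Fin n => Z i ω) atTop
      (𝓝 (matJ d)) := by
    filter_upwards [ae_tendsto_average (E := Fin d → Fin d → ℝ) hZm hZindep hZlaw
      fun C => vecMulVec (covariate C) (covariate C)] with ω hω
    simp only [sampleJ_eq_sum,
      Fin.sum_univ_eq_sum_range fun i => vecMulVec (covariate (Z i ω)) (covariate (Z i ω))]
    exact hω
  have hdet : ∀ᵐ ω ∂P, ∀ᶠ n : ℕ in atTop, IsUnit (sampleJ fun i : Fin n => Z i ω).det := by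
    filter_upwards [hJ] with ω hω
    have hc : Tendsto (fun n : ℕ => (sampleJ fun i : Fin n => Z i ω).det) atTop
        (𝓝 (matJ d).det) := (Continuous.matrix_det continuous_id).continuousAt.tendsto.comp hω
    filter_upwards [hc.eventually_ne (isUnit_det_matJ d).ne_zero] with n hn using IsUnit.mk0 _ hn
  -- Viewed as functions, these matrices carry the metric and Borel structure used for convergence
  -- in measure.
  let B : ℕ → Ω → Fin d → Fin d → ℝ := fun n ω =>
    (sampleJ fun i : Fin n => Z i ω)⁻¹ * matJ d
  have hBm : ∀ n, Measurable (B n) := fun n =>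
    (Measurable.of_discrete (f := fun z : Fin n → Finset (Fin (d + 1)) =>
      (show Fin d → Fin d → ℝ from (sampleJ z)⁻¹ * matJ d))).comp
      (measurable_pi_lambda _ fun i => hZm i)
  have hB : TendstoInMeasure P B atTop fun _ => (1 : Matrix (Fin d) (Fin d) ℝ) := by
    refine tendstoInMeasure_of_tendsto_ae (fun n => (hBm n).aestronglyMeasurable) ?_
    filter_upwards [hJ] with ω hω
    have hinv : ContinuousAt Inv.inv (matJ d) :=
      continuousAt_matrix_inv _
        (Ring.inverse_eq_inv' (G₀ := ℝ) ▸ continuousAt_inv₀ (isUnit_det_matJ d).ne_zero)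
    have := (hinv.tendsto.comp hω).mul_const (matJ d)
    rw [nonsing_inv_mul _ (isUnit_det_matJ d)] at this
    exact this
  have hslutsky := hclt.continuous_comp_prodMk_of_tendstoInMeasure_const
    (g := fun x : EuclideanSpace ℝ (Fin d) × (Fin d → Fin d → ℝ) =>
      (WithLp.toLp 2 ((x.2 : Matrix (Fin d) (Fin d) ℝ) *ᵥ x.1.ofLp) : EuclideanSpace ℝ (Fin d)))
    (by
      refine (PiLp.continuous_toLp 2 _).comp ?_
      exact Continuous.matrix_mulVec (by exact continuous_snd) (by fun_prop))
    hB fun n => (hBm n).aemeasurable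
  simp only [one_mulVec] at hslutsky
  have hm : ∀ n : ℕ, AEMeasurable (fun ω => √n • (φhat n ω - phiTilde ν)) P := by fun_prop
  -- Almost surely the two sequences coincide for all large n, so their difference tends to 0 in
  -- measure.
  refine tendstoInDistribution_of_tendstoInMeasure_sub _ _ hslutsky ?_ hm
  refine tendstoInMeasure_of_tendsto_ae
    (fun n => ((hm n).sub (hslutsky.forall_aemeasurable n)).aestronglyMeasurable) ?_
  filter_upwards [hdet] with ω hω
  refine tendsto_const_nhds.congr' ?_
  filter_upwards [hω, eventually_ne_atTop 0] with n hn hn0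
  simp only [Pi.sub_apply, Pi.zero_apply]
  rw [hφ n ω (rank_design hn), sqrt_smul_lsEstimate_sub ν hn hn0, eq_comm, sub_eq_zero,
    Fin.sum_univ_eq_sum_range fun i => influence ν (Z i ω)]
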